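/- Let $R$ be an associative ring with identity; all modules are unital right $R$-modules. For a module $M$ put $Z(M)=\{m\in M : mI=0 \text{ for some essential right ideal } I \text{ of } R\}$, define the second singular submodule $Z_2(M)\supseteq Z(M)$ by $Z_2(M)/Z(M)=Z(M/Z(M))$, and let $S=\operatorname{End}_R(M)$. A submodule $N$ of $M$ is t-essential in $M$ if for every submodule $L$ of $M$, $N\cap L\le Z_2(M)$ implies $L\le Z_2(M)$; $N$ is t-closed in $M$ if it is not t-essential in any submodule $K$ of $M$ with $N\subsetneq K$. The module $M$ is - t-extending if every t-closed submodule of $M$ is a direct summand of $M$; - t-Baer if $t_M(I)=\{m\in M : Im\le Z_2(M)\}$ is a direct summand of $M$ for every left ideal $I$ of $S$; - Goldie Rickart if $f^{-1}(Z_2(M))$ is a direct summand of $M$ for every $f\in S$. The ring $R$ is right $\Sigma$-t-extending if every free right $R$-module is t-extending. **Theorem 2.6.** For a ring $R$ the following are equivalent: 1. $R$ is right $\Sigma$-t-extending. 2. Every right $R$-module is t-extending. 3. Every right $R$-module is t-Baer. 4. Every right $R$-module is Goldie Rickart. -/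

import Mathlib

/-! Right `R`-modules are modules over `Rᵐᵒᵖ`, with `m r` written `MulOpposite.op r • m`;
right ideals of `R` are elements of `Submodule Rᵐᵒᵖ R`. -/

universe u v w

namespace GoldieRickart

/-- `N` is an essential submodule of `M`. -/
def IsEssential {A : Type u} {M : Type v} [Ring A] [AddCommGroup M] [Module A M]
    (N : Submodule A M) : Prop :=
  ∀ L : Submodule A M, N ⊓ L = ⊥ → L = ⊥

section Essential

variable {A : Type u} {M : Type v} [Ring A] [AddCommGroup M] [Module A M]

theorem isEssential_top : IsEssential (⊤ : Submodule A M) := fun L h => by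
  simpa using h

theorem IsEssential.inf {N K : Submodule A M} (hN : IsEssential N) (hK : IsEssential K) :
    IsEssential (N ⊓ K) := fun L h => hK L (hN (K ⊓ L) (by rwa [← inf_assoc]))

theorem IsEssential.comap {P : Type w} [AddCommGroup P] [Module A P] {N : Submodule A M}
    (hN : IsEssential N) (f : P →ₗ[A] M) : IsEssential (N.comap f) := by
  intro L h
  have h1 : L.map f = ⊥ := by
    apply hN
    rw [eq_bot_iff]
    rintro _ ⟨hx, y, hy, rfl⟩
    have : y ∈ N.comap f ⊓ L := ⟨hx, hy⟩
    rw [h, Submodule.mem_bot] at this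
    simp [this]
  rw [eq_bot_iff, ← h]
  refine le_inf (fun y hy => ?_) le_rfl
  have : f y ∈ L.map f := Submodule.mem_map_of_mem hy
  rw [h1, Submodule.mem_bot] at this
  simp [this]

end Essential

section Torsion

variable (R : Type u) (M : Type v) [Ring R] [AddCommGroup M] [Module Rᵐᵒᵖ M]

/-- The singular submodule `Z(M) = {m | m I = 0 for some essential right ideal I of R}`. -/
def singularSubmodule : Submodule Rᵐᵒᵖ M where
  carrier := {m | ∃ I : Submodule Rᵐᵒᵖ R, IsEssential I ∧ ∀ a ∈ I, MulOpposite.op a • m = 0}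
  zero_mem' := ⟨⊤, isEssential_top, fun _ _ => smul_zero _⟩
  add_mem' := by
    rintro x y ⟨I, hI, hx⟩ ⟨J, hJ, hy⟩
    exact ⟨I ⊓ J, hI.inf hJ, fun a ha => by rw [smul_add, hx a ha.1, hy a ha.2, add_zero]⟩
  smul_mem' := by
    rintro r x ⟨I, hI, hx⟩
    refine ⟨I.comap (DistribSMul.toLinearMap Rᵐᵒᵖ R r.unop), hI.comap _, fun a ha => ?_⟩
    have := hx (r.unop * a) ha
    rwa [MulOpposite.op_mul, MulOpposite.op_unop, mul_smul] at this

/-- The second singular (Goldie torsion) submodule `Z₂(M)`, given by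
`Z₂(M) / Z(M) = Z(M / Z(M))`. -/
def goldieTorsion : Submodule Rᵐᵒᵖ M :=
  (singularSubmodule R (M ⧸ singularSubmodule R M)).comap (singularSubmodule R M).mkQ

/-- `M` is Goldie Rickart: `f⁻¹(Z₂(M))` is a direct summand of `M` for every endomorphism `f`. -/
def IsGoldieRickart : Prop :=
  ∀ f : Module.End Rᵐᵒᵖ M, IsComplemented ((goldieTorsion R M).comap f)

/-- `t_M(I) = {m ∈ M | I m ≤ Z₂(M)}` for a left ideal `I` of `End_R(M)`. -/
def tAnnihilator (I : Ideal (Module.End Rᵐᵒᵖ M)) : Submodule Rᵐᵒᵖ M :=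
  ⨅ f ∈ I, (goldieTorsion R M).comap f

/-- `M` is t-Baer: `t_M(I)` is a direct summand of `M` for every left ideal `I` of `End_R(M)`. -/
def IsTBaer : Prop :=
  ∀ I : Ideal (Module.End Rᵐᵒᵖ M), IsComplemented (tAnnihilator R M I)

variable {M}

/-- `N` is t-essential in `M`: every `L ≤ M` with `N ∩ L ≤ Z₂(M)` satisfies `L ≤ Z₂(M)`. -/
def IsTEssential (N : Submodule Rᵐᵒᵖ M) : Prop :=
  ∀ L : Submodule Rᵐᵒᵖ M, N ⊓ L ≤ goldieTorsion R M → L ≤ goldieTorsion R M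

/-- `N` is t-closed in `M`: it has no proper t-essential extension in `M`, that is, if `N` is
t-essential in a submodule `K` of `M` (as a submodule of the module `K`) then `N = K`. -/
def IsTClosed (N : Submodule Rᵐᵒᵖ M) : Prop :=
  ∀ K : Submodule Rᵐᵒᵖ M, N ≤ K → IsTEssential R (N.submoduleOf K) → N = K

variable (M)

/-- `M` is t-extending: every t-closed submodule of `M` is a direct summand of `M`. -/
def IsTExtending : Prop :=
  ∀ N : Submodule Rᵐᵒᵖ M, IsTClosed R N → IsComplemented N

end Torsion

/-- `R` is right Σ-t-extending: every free right `R`-module is t-extending. The modules range over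
a universe at least as large as that of `R`. -/
def IsRightSigmaTExtending (R : Type u) [Ring R] : Prop :=
  ∀ (F : Type (max u v)) [AddCommGroup F] [Module Rᵐᵒᵖ F],
    Module.Free Rᵐᵒᵖ F → IsTExtending R F

end GoldieRickart

/-! The proof rests on one notion: a submodule `N` of `M` is *saturated* if `x I ≤ N` for an
essential right ideal `I` forces `x ∈ N`; equivalently, `M / N` is nonsingular.

* The t-closed submodules are exactly the saturated ones (`isTClosed_iff_isSaturated`).
* `Z₂(M)` is the least saturated submodule of `M` (`isSaturated_goldieTorsion`,
  `IsSaturated.goldieTorsion_le`).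
* Saturated submodules are stable under preimages and intersections, so every `t_M(I)` is
  saturated. Hence t-extending implies t-Baer, and t-Baer implies Goldie Rickart because
  `t_M(S f) = f⁻¹(Z₂(M))`.
* If `g : P → M` is surjective and `g⁻¹(N)` is a direct summand of `P`, then `N` is a direct summand
  of `M` (`isComplemented_of_comap`).

The last point brings everything back to t-extending modules. A saturated `N ≤ M` pulls back to a
saturated submodule of a free module mapping onto `M`, so free modules being t-extending suffices.
If all modules are Goldie Rickart, apply this to the endomorphism `(x, y) ↦ (0, x + N)` of
`M × M / N`: since `M / N` has no Goldie torsion, the preimage of `Z₂` is the preimage of `N` under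
the first projection, so `N` is a direct summand of `M`. -/

namespace GoldieRickart

section Saturated

variable {R : Type u} {M : Type v} {P : Type w} [Ring R] [AddCommGroup M] [Module Rᵐᵒᵖ M]
  [AddCommGroup P] [Module Rᵐᵒᵖ P]

variable (R) in
/-- The homomorphism of right modules `R → M`, `a ↦ x a`. -/
def orbitMap (x : M) : R →ₗ[Rᵐᵒᵖ] M where
  toFun a := MulOpposite.op a • x
  map_add' a b := by rw [MulOpposite.op_add, add_smul]
  map_smul' r a := by
    rw [MulOpposite.smul_eq_mul_unop, MulOpposite.op_mul, MulOpposite.op_unop, mul_smul,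
      RingHom.id_apply]

@[simp]
theorem orbitMap_apply (x : M) (a : R) : orbitMap R x a = MulOpposite.op a • x := rfl

variable (R) in
/-- `N` is saturated in `M`: if `x I ≤ N` for some essential right ideal `I` of `R`, then `x ∈ N`.
This says that `M / N` is nonsingular, without mention of the quotient. -/
def IsSaturated (N : Submodule Rᵐᵒᵖ M) : Prop :=
  ∀ (x : M) (I : Submodule Rᵐᵒᵖ R), IsEssential I → (∀ a ∈ I, MulOpposite.op a • x ∈ N) → x ∈ N

theorem IsSaturated.comap {N : Submodule Rᵐᵒᵖ M} (hN : IsSaturated R N) (f : P →ₗ[Rᵐᵒᵖ] M) :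
    IsSaturated R (N.comap f) := fun x I hI h =>
  hN (f x) I hI fun a ha => by simpa using h a ha

theorem IsSaturated.iInf {ι : Sort*} {N : ι → Submodule Rᵐᵒᵖ M} (hN : ∀ i, IsSaturated R (N i)) :
    IsSaturated R (⨅ i, N i) := fun x I hI h =>
  (Submodule.mem_iInf _).2 fun i => hN i x I hI fun a ha => (Submodule.mem_iInf _).1 (h a ha) i

theorem IsSaturated.bot_quotient {N : Submodule Rᵐᵒᵖ M} (hN : IsSaturated R N) :
    IsSaturated R (⊥ : Submodule Rᵐᵒᵖ (M ⧸ N)) := by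
  intro y I hI h
  obtain ⟨x, rfl⟩ := N.mkQ_surjective y
  refine (Submodule.Quotient.mk_eq_zero N).2 (hN x I hI fun a ha => ?_)
  exact (Submodule.Quotient.mk_eq_zero N).1 (h a ha)

theorem mem_goldieTorsion_iff {x : M} : x ∈ goldieTorsion R M ↔
    ∃ I : Submodule Rᵐᵒᵖ R, IsEssential I ∧ ∀ a ∈ I, MulOpposite.op a • x ∈ singularSubmodule R M :=
  exists_congr fun _ => and_congr_right fun _ => forall₂_congr fun _ _ =>
    Submodule.Quotient.mk_eq_zero _

/-- The Goldie torsion is idempotent: `M / Z₂(M)` is nonsingular. -/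
theorem isSaturated_goldieTorsion : IsSaturated R (goldieTorsion R M) := by
  intro x I hI h
  refine mem_goldieTorsion_iff.2 ⟨(singularSubmodule R M).comap (orbitMap R x), ?_, fun a ha => ha⟩
  intro L hL
  refine hI L (eq_bot_iff.2 fun a ha => ?_)
  obtain ⟨E, hE, hxa⟩ := mem_goldieTorsion_iff.1 (h a ha.1)
  -- `a E` lies in both `L` and the colon ideal of `x`, so it vanishes; hence `x a` is singular.
  have haE : ∀ e ∈ E, a * e = 0 := fun e he => by
    rw [← Submodule.mem_bot Rᵐᵒᵖ, ← hL]
    refine ⟨?_, L.smul_mem (MulOpposite.op e) ha.2⟩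
    have := hxa e he
    rwa [← mul_smul, ← MulOpposite.op_mul] at this
  rw [← hL]
  refine ⟨⟨E, hE, fun e he => ?_⟩, ha.2⟩
  rw [orbitMap_apply, ← mul_smul, ← MulOpposite.op_mul, haE e he, MulOpposite.op_zero, zero_smul]

theorem IsSaturated.goldieTorsion_le {N : Submodule Rᵐᵒᵖ M} (hN : IsSaturated R N) :
    goldieTorsion R M ≤ N := by
  have hZ : singularSubmodule R M ≤ N := fun x ⟨I, hI, h⟩ =>
    hN x I hI fun a ha => by rw [h a ha]; exact N.zero_mem
  intro x hx
  obtain ⟨I, hI, h⟩ := mem_goldieTorsion_iff.1 hx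
  exact hN x I hI fun a ha => hZ (h a ha)

/-- Homomorphisms preserve Goldie torsion. -/
theorem goldieTorsion_le_comap (f : M →ₗ[Rᵐᵒᵖ] P) :
    goldieTorsion R M ≤ (goldieTorsion R P).comap f :=
  (isSaturated_goldieTorsion.comap f).goldieTorsion_le

theorem isSaturated_tAnnihilator (I : Ideal (Module.End Rᵐᵒᵖ M)) :
    IsSaturated R (tAnnihilator R M I) :=
  .iInf fun f => .iInf fun _ => isSaturated_goldieTorsion.comap f

theorem tAnnihilator_span_singleton (f : Module.End Rᵐᵒᵖ M) :
    tAnnihilator R M (Ideal.span {f}) = (goldieTorsion R M).comap f := by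
  refine le_antisymm (iInf₂_le f (Ideal.mem_span_singleton_self f)) (le_iInf₂ fun g hg => ?_)
  obtain ⟨h, rfl⟩ := Ideal.mem_span_singleton'.1 hg
  exact Submodule.comap_mono (f := f) (goldieTorsion_le_comap h)

theorem IsTClosed.isSaturated {N : Submodule Rᵐᵒᵖ M} (hN : IsTClosed R N) : IsSaturated R N := by
  -- `N` is t-essential in the preimage of `Z(M / N)`, hence equal to it.
  have h := hN ((singularSubmodule R (M ⧸ N)).comap N.mkQ)
    (fun x hx => by
      rw [Submodule.mem_comap, Submodule.mkQ_apply, (Submodule.Quotient.mk_eq_zero N).2 hx]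
      exact zero_mem _)
    (fun L hL x hx => by
      obtain ⟨I, hI, hxI⟩ := x.2
      exact isSaturated_goldieTorsion x I hI fun a ha =>
        hL ⟨(Submodule.Quotient.mk_eq_zero N).1 (hxI a ha), L.smul_mem _ hx⟩)
  intro x I hI hx
  rw [h]
  exact ⟨I, hI, fun a ha => (Submodule.Quotient.mk_eq_zero N).2 (hx a ha)⟩

theorem IsSaturated.isTClosed {N : Submodule Rᵐᵒᵖ M} (hN : IsSaturated R N) : IsTClosed R N := by
  intro K hNK hK
  -- Since `Z₂(K) ≤ N`, a t-essential `N` is essential in `K`, so `K / N` is singular.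
  have hZ : goldieTorsion R K ≤ N.submoduleOf K := (hN.comap K.subtype).goldieTorsion_le
  have hess : IsEssential (N.submoduleOf K) := fun L hL => by
    have hLZ : L ≤ goldieTorsion R K := hK L (hL.trans_le bot_le)
    rw [← hL, inf_eq_right.2 (hLZ.trans hZ)]
  exact le_antisymm hNK fun x hx =>
    hN x _ (hess.comap (orbitMap R (⟨x, hx⟩ : K))) fun a ha => ha

theorem isTClosed_iff_isSaturated {N : Submodule Rᵐᵒᵖ M} : IsTClosed R N ↔ IsSaturated R N :=
  ⟨IsTClosed.isSaturated, IsSaturated.isTClosed⟩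

end Saturated

/-- Being a direct summand descends along surjections: the image of a complement of `g⁻¹(N)` is a
complement of `N`. -/
theorem isComplemented_of_comap {A : Type u} {M : Type v} {P : Type w} [Ring A] [AddCommGroup M]
    [Module A M] [AddCommGroup P] [Module A P] {g : P →ₗ[A] M} (hg : Function.Surjective g)
    {N : Submodule A M} (h : IsComplemented (N.comap g)) : IsComplemented N := by
  obtain ⟨L, hL⟩ := h
  refine ⟨L.map g, Submodule.disjoint_def.2 ?_, codisjoint_iff.2 ?_⟩
  · rintro _ hN ⟨l, hl, rfl⟩
    rw [Submodule.disjoint_def.1 hL.disjoint l hN hl, map_zero]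
  · rw [← Submodule.map_comap_eq_of_surjective hg N, ← Submodule.map_sup, hL.sup_eq_top,
      Submodule.map_top, LinearMap.range_eq_top.2 hg]

section Module

variable {R : Type u} [Ring R] {M : Type v} [AddCommGroup M] [Module Rᵐᵒᵖ M]

theorem IsTExtending.of_surjective {P : Type w} [AddCommGroup P] [Module Rᵐᵒᵖ P]
    (hP : IsTExtending R P) {g : P →ₗ[Rᵐᵒᵖ] M} (hg : Function.Surjective g) :
    IsTExtending R M := fun _ hN =>
  isComplemented_of_comap hg
    (hP _ (isTClosed_iff_isSaturated.2 ((isTClosed_iff_isSaturated.1 hN).comap g)))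

theorem IsTExtending.isTBaer (h : IsTExtending R M) : IsTBaer R M := fun I =>
  h _ (isTClosed_iff_isSaturated.2 (isSaturated_tAnnihilator I))

theorem IsTBaer.isGoldieRickart (h : IsTBaer R M) : IsGoldieRickart R M := fun f =>
  tAnnihilator_span_singleton f ▸ h (Ideal.span {f})

theorem IsTClosed.isComplemented_of_isGoldieRickart {N : Submodule Rᵐᵒᵖ M} (hN : IsTClosed R N)
    (h : IsGoldieRickart R (M × M ⧸ N)) : IsComplemented N := by
  have hZ : goldieTorsion R (M × M ⧸ N) ≤
      (⊥ : Submodule Rᵐᵒᵖ (M ⧸ N)).comap (.snd Rᵐᵒᵖ M (M ⧸ N)) :=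
    (hN.isSaturated.bot_quotient.comap _).goldieTorsion_le
  have hf := h (.inr Rᵐᵒᵖ M (M ⧸ N) ∘ₗ N.mkQ ∘ₗ .fst Rᵐᵒᵖ M (M ⧸ N))
  have heq : (goldieTorsion R (M × M ⧸ N)).comap
      (.inr Rᵐᵒᵖ M (M ⧸ N) ∘ₗ N.mkQ ∘ₗ .fst Rᵐᵒᵖ M (M ⧸ N)) = N.comap (.fst Rᵐᵒᵖ M (M ⧸ N)) := by
    ext x
    refine ⟨fun hx => (Submodule.Quotient.mk_eq_zero N).1 (hZ hx), fun hx => ?_⟩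
    have h0 : N.mkQ x.1 = 0 := (Submodule.Quotient.mk_eq_zero N).2 hx
    rw [Submodule.mem_comap, LinearMap.comp_apply, LinearMap.comp_apply, LinearMap.fst_apply, h0,
      map_zero]
    exact zero_mem _
  rw [heq] at hf
  exact isComplemented_of_comap LinearMap.fst_surjective hf

end Module

end GoldieRickart

open GoldieRickart in
theorem theorem2p6 (R : Type u) [Ring R] :
    List.TFAE [
      GoldieRickart.IsRightSigmaTExtending.{u, v} R,
      ∀ (M : Type (max u v)) [AddCommGroup M] [Module Rᵐᵒᵖ M], GoldieRickart.IsTExtending R M,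
      ∀ (M : Type (max u v)) [AddCommGroup M] [Module Rᵐᵒᵖ M], GoldieRickart.IsTBaer R M,
      ∀ (M : Type (max u v)) [AddCommGroup M] [Module Rᵐᵒᵖ M],
        GoldieRickart.IsGoldieRickart R M] := by
  tfae_have 1 → 2 := fun h M _ _ =>
    (h (M →₀ Rᵐᵒᵖ) inferInstance).of_surjective (Finsupp.linearCombination_id_surjective Rᵐᵒᵖ M)
  tfae_have 2 → 3 := fun h M _ _ => (h M).isTBaer
  tfae_have 3 → 4 := fun h M _ _ => (h M).isGoldieRickart
  tfae_have 4 → 1 := fun h F _ _ _ N hN => hN.isComplemented_of_isGoldieRickart (h (F × F ⧸ N))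
  tfae_finish
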